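/- All rings are associative with identity $1$ (not necessarily commutative; the zero ring is allowed), and $J(R)$ denotes the Jacobson radical of a ring $R$. A ring $R$ is called Yaqub nil-clean if for every $a\in R$ at least one of $a+a^3$ and $a-a^3$ is nilpotent. A Yaqub ring is a subdirect product of copies of $\mathbb{Z}_3$, i.e. a ring $S$ admitting, for some (possibly empty) index set $I$, an injective ring homomorphism $S\to\prod_{i\in I}\mathbb{Z}_3$ whose composition with each coordinate projection is surjective. An ideal is nil if each of its elements is nilpotent. Theorem. A ring $R$ is Yaqub nil-clean if and only if $R$ is isomorphic to $R_1$, $R_2$, $R_3$, $R_1\times R_2$ or $R_1\times R_3$ for some rings $R_1,R_2,R_3$ such that 1. $R_1/J(R_1)$ is Boolean and $J(R_1)$ is nil; 2. $R_2/J(R_2)$ is a Yaqub ring and $J(R_2)$ is nil; 3. $R_3/J(R_3)\cong\mathbb{Z}_5$ and $J(R_3)$ is nil. -/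

import Mathlib

universe u

/-- A ring is Yaqub nil-clean if for every `a`, at least one of `a + a ^ 3` and `a - a ^ 3` is
nilpotent. -/
def IsYaqubNilClean (R : Type u) [Ring R] : Prop :=
  ∀ a : R, IsNilpotent (a + a ^ 3) ∨ IsNilpotent (a - a ^ 3)

/-- The Jacobson radical of the ring is nil: each of its elements is nilpotent. -/
def JacobsonIsNil (R : Type u) [Ring R] : Prop :=
  ∀ x : R, x ∈ Ring.jacobson R → IsNilpotent x

/-- A ring is Boolean if every element is idempotent (the zero ring is Boolean). -/
def IsBooleanRing (R : Type u) [Ring R] : Prop :=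
  ∀ a : R, IsIdempotentElem a

/-- A Yaqub ring: a subdirect product of copies of `ZMod 3`, that is, a ring with an injective
(unital) homomorphism into a direct power of `ZMod 3` each of whose components is surjective. The
index set may be empty, which gives the zero ring. -/
def IsYaqubRing (R : Type u) [Ring R] : Prop :=
  ∃ (I : Type u) (f : R →+* (I → ZMod 3)),
    Function.Injective f ∧ ∀ i : I, Function.Surjective fun r : R => f r i

/-- `R / J(R)` is Boolean and `J(R)` is nil. -/
def IsNilBoolean (R : Type u) [Ring R] : Prop :=
  IsBooleanRing (R ⧸ Ring.jacobson R) ∧ JacobsonIsNil R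

/-- `R / J(R)` is a Yaqub ring and `J(R)` is nil. -/
def IsNilYaqub (R : Type u) [Ring R] : Prop :=
  IsYaqubRing (R ⧸ Ring.jacobson R) ∧ JacobsonIsNil R

/-- `R / J(R)` is isomorphic to `ZMod 5` and `J(R)` is nil. -/
def IsNilZModFive (R : Type u) [Ring R] : Prop :=
  Nonempty ((R ⧸ Ring.jacobson R) ≃+* ZMod 5) ∧ JacobsonIsNil R

/-! Testing `a = 2` shows that 10 or 6 is nilpotent, so `R` splits into a factor where 2 is
nilpotent and one where 5 or 3 is. The radical is nil, which leaves a semiprimitive ring of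
characteristic 2, 3 or 5. It is reduced (`IsYaqubNilClean.isReduced`): a nonzero square-zero element
would produce 2 × 2 matrix units, and some matrix over the prime field violates the condition. Now
`a ^ 3 = ± a` for all `a`, which forces a Boolean ring, a Yaqub ring or `ZMod 5`. Conversely, a
Boolean factor is harmless because there both `a + a ^ 3` and `a - a ^ 3` are nilpotent. -/

section Jacobson

variable {R : Type*} [Ring R]

theorem IsNilpotent.of_mul_of_left_inverse {x w z : R} (h : IsNilpotent (x * w))
    (hc : Commute w x) (hz : z * w = 1) : IsNilpotent x := by
  obtain ⟨n, hn⟩ := h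
  refine ⟨n, ?_⟩
  rw [hc.symm.mul_pow, ← (hc.pow_pow n n).eq] at hn
  rw [← one_mul (x ^ n), ← pow_mul_pow_eq_one n hz, mul_assoc, hn, mul_zero]

theorem Ring.mem_jacobson_iff_exists_left_inverse {x : R} :
    x ∈ Ring.jacobson R ↔ ∀ y, ∃ z, z * (1 + y * x) = 1 := by
  rw [← Ideal.jacobson_bot, Ideal.mem_jacobson_iff]
  refine forall_congr' fun y ↦ exists_congr fun z ↦ ?_
  rw [Ideal.mem_bot, sub_eq_zero, mul_add, mul_one, mul_assoc, add_comm]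

/-- A nil left ideal is quasi-regular, hence inside the radical. -/
theorem exists_not_isNilpotent_mul (hJ : Ring.jacobson R = ⊥) {x : R} (hx : x ≠ 0) :
    ∃ y, ¬ IsNilpotent (y * x) := by
  by_contra! h
  refine hx (Ideal.mem_bot.1 (hJ ▸ Ring.mem_jacobson_iff_exists_left_inverse.2 fun y ↦ ?_))
  exact (h y).isUnit_one_add.exists_left_inv

theorem isNilpotent_of_mk_eq_zero {I : Ideal R} [I.IsTwoSided] (hI : ∀ x ∈ I, IsNilpotent x) {x : R}
    (hx : Ideal.Quotient.mk I x = 0) : IsNilpotent x :=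
  hI x (Ideal.Quotient.eq_zero_iff_mem.1 hx)

end Jacobson

/-! ### Lifting and centrality of idempotents -/

section Idempotents

variable {R : Type*} [Ring R]

/-- If `b` is not nilpotent but `b * (1 - b * G(b))` is, for an integer polynomial `G`, then the
left ideal generated by `b` contains a nonzero idempotent. -/
theorem exists_isIdempotentElem_mul_of_isNilpotent {b : R} (G : Polynomial ℤ)
    (hG : IsNilpotent (b * (1 - b * Polynomial.aeval b G))) (hb : ¬ IsNilpotent b) :
    ∃ d, IsIdempotentElem (d * b) ∧ d * b ≠ 0 := by
  obtain ⟨m, hm⟩ := hG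
  have hbc (P : Polynomial ℤ) : Commute b (Polynomial.aeval b P) := by
    simpa using (Polynomial.commute_X P).map (Polynomial.aeval b)
  have hm0 : m ≠ 0 := by
    rintro rfl
    rw [pow_zero] at hm
    exact hb ⟨1, by rw [← mul_one (b ^ 1), hm, mul_zero]⟩
  -- With `h = H(b)`, `b * h = 1 - (1 - b * G(b)) ^ m` fixes `b ^ m`, so `(b * h) ^ m` is
  -- idempotent.
  obtain ⟨H, hH⟩ : Polynomial.X ∣ 1 - (1 - Polynomial.X * G) ^ m := by
    have h := sub_dvd_pow_sub_pow 1 (1 - Polynomial.X * G) m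
    rw [one_pow, sub_sub_cancel] at h
    exact (dvd_mul_right _ _).trans h
  have hH' := congrArg (Polynomial.aeval b) hH
  simp only [map_sub, map_one, map_pow, map_mul, Polynomial.aeval_X] at hH'
  set h := Polynomial.aeval b H with h_def
  have hbh : Commute b h := hbc H
  have hstep : b ^ m * (b * h) = b ^ m := by
    rw [← hH', mul_sub, mul_one, sub_eq_self, ← Commute.mul_pow _ m, hm]
    exact (Commute.one_right b).sub_right ((Commute.refl b).mul_right (hbc G))
  have hpow (j : ℕ) : b ^ m * (b * h) ^ j = b ^ m := by
    induction j with
    | zero => simp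
    | succ j ih => rw [pow_succ, ← mul_assoc, ih, hstep]
  have he : (h ^ m * b ^ (m - 1)) * b = (b * h) ^ m := by
    rw [mul_assoc, ← pow_succ, Nat.sub_add_cancel (Nat.one_le_iff_ne_zero.2 hm0),
      hbh.mul_pow, (hbh.pow_pow m m).eq]
  refine ⟨h ^ m * b ^ (m - 1), ?_, ?_⟩
  · rw [he, IsIdempotentElem]
    nth_rw 1 [hbh.mul_pow, (hbh.pow_pow m m).eq]
    rw [mul_assoc, hpow, hbh.mul_pow, (hbh.pow_pow m m).eq]
  · intro h0
    rw [he] at h0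
    exact hb ⟨m, by rw [← hpow m, h0, mul_zero]⟩

/-- The corners `e * x * (1 - e)` and `(1 - e) * x * e` square to zero. -/
theorem IsIdempotentElem.commute_of_isReduced [IsReduced R] {e : R} (he : IsIdempotentElem e)
    (x : R) : Commute e x := by
  have h1 : e * x * (1 - e) = 0 := by
    refine IsReduced.eq_zero _ ⟨2, ?_⟩
    have : (1 - e) * e = 0 := by rw [sub_mul, one_mul, he.eq, sub_self]
    rw [sq, show e * x * (1 - e) * (e * x * (1 - e)) = e * x * ((1 - e) * e) * (x * (1 - e)) by
      noncomm_ring, this, mul_zero, zero_mul]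
  have h2 : (1 - e) * x * e = 0 := by
    refine IsReduced.eq_zero _ ⟨2, ?_⟩
    have : e * (1 - e) = 0 := by rw [mul_sub, mul_one, he.eq, sub_self]
    rw [sq, show (1 - e) * x * e * ((1 - e) * x * e) = (1 - e) * x * (e * (1 - e)) * (x * e) by
      noncomm_ring, this, mul_zero, zero_mul]
  rw [mul_sub, mul_one, sub_eq_zero] at h1
  rw [sub_mul, one_mul, sub_mul, sub_eq_zero] at h2
  exact h1.trans h2.symm

end Idempotents

/-! ### Nil radical and reducedness -/

namespace IsYaqubNilClean

theorem of_surjective {R S : Type*} [Ring R] [Ring S] (h : IsYaqubNilClean R) (f : R →+* S)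
    (hf : Function.Surjective f) : IsYaqubNilClean S := by
  intro a
  obtain ⟨a, rfl⟩ := hf a
  refine (h a).imp (fun h ↦ ?_) fun h ↦ ?_
  · simpa using h.map f
  · simpa using h.map f

variable {R : Type*} [Ring R]

/-- `x ± x ^ 3 = x * (1 ± x * x)`, and the second factor is left invertible for `x` in the radical.
-/
theorem jacobsonIsNil (h : IsYaqubNilClean R) : JacobsonIsNil R := by
  intro x hx
  rw [Ring.mem_jacobson_iff_exists_left_inverse] at hx
  rcases h x with h | h
  · obtain ⟨z, hz⟩ := hx x
    rw [show x + x ^ 3 = x * (1 + x * x) by noncomm_ring] at h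
    exact h.of_mul_of_left_inverse ((Commute.one_left x).add_left (by simp)) hz
  · obtain ⟨z, hz⟩ := hx (-x)
    rw [show x - x ^ 3 = x * (1 + -x * x) by noncomm_ring] at h
    exact h.of_mul_of_left_inverse ((Commute.one_left x).add_left (by simp)) hz

theorem exists_isIdempotentElem_mul (h : IsYaqubNilClean R) {b : R} (hb : ¬ IsNilpotent b) :
    ∃ d, IsIdempotentElem (d * b) ∧ d * b ≠ 0 := by
  rcases h b with h | h
  · refine exists_isIdempotentElem_mul_of_isNilpotent (-Polynomial.X) ?_ hb
    rw [map_neg, Polynomial.aeval_X, show b * (1 - b * -b) = b + b ^ 3 by noncomm_ring]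
    exact h
  · refine exists_isIdempotentElem_mul_of_isNilpotent Polynomial.X ?_ hb
    rw [Polynomial.aeval_X, show b * (1 - b * b) = b - b ^ 3 by noncomm_ring]
    exact h

/-- The elements `y`, `t` generate (as `e₁₂`, `e₂₁`) a copy of the `2 × 2` matrix units. -/
theorem eq_zero_of_matrix_units (h : IsYaqubNilClean R)
    (hp : (2 : R) = 0 ∨ (3 : R) = 0 ∨ (5 : R) = 0) {y t : R} (hy : y * y = 0) (ht : t * t = 0)
    (hyty : y * (t * y) = y) (htyt : t * (y * t) = t) : y = 0 := by
  have hy' (z : R) : y * (y * z) = 0 := by rw [← mul_assoc, hy, zero_mul]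
  have ht' (z : R) : t * (t * z) = 0 := by rw [← mul_assoc, ht, zero_mul]
  -- In characteristic 5 the witness is diag(2, 1). Otherwise it is the Fibonacci matrix `a` with `a
  -- * a = a + E`, where `E` is the identity of the corner; in characteristic 5 this one fails, as
  -- `a + a ^ 3 = 3a + E` has trace 5 and determinant -5.
  by_cases h5 : (5 : R) = 0
  · replace h5 (z : R) : z + z + z + z + z = 0 := by
      rw [← zero_mul z, ← h5]
      noncomm_ring
    rcases h (t * y + 2 * (y * t)) with h | h
    · have hid : IsIdempotentElem (t * y) := by
        rw [IsIdempotentElem, mul_assoc, hyty]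
      have key : t * y + 2 * (y * t) + (t * y + 2 * (y * t)) ^ 3 = t * y + t * y := by
        rw [pow_three]
        simp only [two_mul, mul_add, add_mul, mul_assoc, hyty, htyt, hy', ht', mul_zero, add_zero,
          zero_add]
        linear_combination (norm := abel) h5 (y * t) + h5 (y * t)
      rw [key] at h
      have h6 := (Commute.refl (t * y + t * y)).isNilpotent_mul_right h
      have : (t * y + t * y) * (t * y + t * y) = -(t * y) := by
        rw [mul_add, add_mul, hid.eq]
        linear_combination (norm := abel) h5 (t * y)
      rw [this, isNilpotent_neg_iff] at h6
      rw [← hyty, hid.eq_zero_of_isNilpotent h6, mul_zero]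
    · have hid : IsIdempotentElem (y * t) := by
        rw [IsIdempotentElem, mul_assoc, htyt]
      have key : t * y + 2 * (y * t) - (t * y + 2 * (y * t)) ^ 3 = -(y * t) := by
        rw [pow_three]
        simp only [two_mul, mul_add, add_mul, mul_assoc, hyty, htyt, hy', ht', mul_zero, add_zero,
          zero_add]
        linear_combination (norm := abel) -h5 (y * t)
      rw [key, isNilpotent_neg_iff] at h
      rw [← hyty, ← mul_assoc, hid.eq_zero_of_isNilpotent h, zero_mul]
  · set a := y + t + t * y with ha
    set E := t * y + y * t with hE
    have hEE : IsIdempotentElem E := by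
      simp only [IsIdempotentElem, hE, mul_add, add_mul, mul_assoc, hyty, htyt, hy', ht', mul_zero,
        add_zero, zero_add]
    have haE : a * E = a := by
      simp only [ha, hE, mul_add, add_mul, mul_assoc, hyty, htyt, hy', ht', mul_zero, add_zero,
        zero_add]
      abel
    have hEa : E * a = a := by
      simp only [ha, hE, mul_add, add_mul, mul_assoc, hy, ht, hyty, htyt, ht', mul_zero, add_zero,
        zero_add]
    have haa : a * a = a + E := by
      simp only [ha, hE, mul_add, add_mul, mul_assoc, hy, ht, hyty, htyt, ht', mul_zero, add_zero,
        zero_add]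
      abel
    have ha3 : a ^ 3 = a + a + E := by
      rw [pow_three, haa, mul_add, haa, haE]
      abel
    have hyE : E * y = y := by
      simp only [hE, add_mul, mul_assoc, hyty, hy, mul_zero, zero_add]
    suffices hn : IsNilpotent E by
      rw [← hyE, hEE.eq_zero_of_isNilpotent hn, zero_mul]
    have of_sq (hn : IsNilpotent (a + E)) : IsNilpotent E := by
      rw [← haa, ← sq] at hn
      have hEq : a * (a - E) = E := by
        rw [mul_sub, haa, haE, add_sub_cancel_left]
      rw [← hEq]
      refine Commute.isNilpotent_mul_right ?_ hn.of_pow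
      exact (Commute.refl a).sub_right (haE.trans hEa.symm)
    rcases h a with h | h
    · rcases hp with h2 | h3 | h5'
      · refine of_sq ?_
        have : a + a ^ 3 = a + E := by
          have : a + a = 0 := by rw [← two_mul, h2, zero_mul]
          rw [ha3]
          linear_combination (norm := abel) this
        rwa [this] at h
      · have : a + a ^ 3 = E := by
          have : a + a + a = 0 := by
            rw [← zero_mul a, ← h3]
            noncomm_ring
          rw [ha3]
          linear_combination (norm := abel) this
        rwa [this] at h
      · exact absurd h5' h5
    · refine of_sq ?_
      rw [ha3, show a - (a + a + E) = -(a + E) by abel, isNilpotent_neg_iff] at h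
      exact h

theorem isReduced (h : IsYaqubNilClean R) (hJ : Ring.jacobson R = ⊥)
    (hp : (2 : R) = 0 ∨ (3 : R) = 0 ∨ (5 : R) = 0) : IsReduced R := by
  rw [isReduced_iff_pow_one_lt 2 one_lt_two]
  intro x hx
  rw [sq] at hx
  by_contra hx0
  obtain ⟨r, hr⟩ := exists_not_isNilpotent_mul hJ hx0
  obtain ⟨c, hid, hne⟩ := h.exists_isIdempotentElem_mul hr
  rw [← mul_assoc] at hid hne
  set d := c * r
  set e := d * x with he
  have hex : e * x = 0 := by rw [he, mul_assoc, hx, mul_zero]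
  have hee (z : R) : e * (e * z) = e * z := by rw [← mul_assoc, hid.eq]
  have hexz (z : R) : e * (x * z) = 0 := by rw [← mul_assoc, hex, zero_mul]
  have hdxz (z : R) : d * (x * z) = e * z := by rw [← mul_assoc]
  -- The factor `1 - e` makes `t * t = 0` and, since `e * x = 0`, does not disturb `t * y = e`.
  have hty : e * d * (1 - e) * (x * e) = e := by
    simp only [mul_sub, mul_one, sub_mul, mul_assoc, hexz, hdxz, hid.eq, mul_zero, sub_zero]
  have hy0 := h.eq_zero_of_matrix_units hp (y := x * e) (t := e * d * (1 - e))
    (by rw [mul_assoc, hexz, mul_zero])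
    (by simp only [mul_sub, mul_one, sub_mul, mul_assoc, hee, sub_self])
    (by rw [hty, mul_assoc, hid.eq])
    (by rw [← mul_assoc, hty, ← mul_assoc, ← mul_assoc, hid.eq])
  exact hne (by rw [← hty, hy0, mul_zero])

theorem isReduced_quotient_jacobson (h : IsYaqubNilClean R) {p : ℕ} (hp : IsNilpotent (p : R))
    (hp' : p = 2 ∨ p = 3 ∨ p = 5) :
    ((p : ℕ) : R ⧸ Ring.jacobson R) = 0 ∧ IsReduced (R ⧸ Ring.jacobson R) := by
  have h0 : ((p : ℕ) : R ⧸ Ring.jacobson R) = 0 := by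
    rw [← map_natCast (Ideal.Quotient.mk (Ring.jacobson R)), Ideal.Quotient.eq_zero_iff_mem,
      Ring.mem_jacobson_iff_exists_left_inverse]
    intro y
    exact ((Nat.cast_commute p y).symm.isNilpotent_mul_left hp).isUnit_one_add.exists_left_inv
  refine ⟨h0, (h.of_surjective _ Ideal.Quotient.mk_surjective).isReduced
    (Ring.jacobson_quotient_jacobson R) ?_⟩
  rcases hp' with rfl | rfl | rfl
  · exact .inl (mod_cast h0)
  · exact .inr (.inl (mod_cast h0))
  · exact .inr (.inr (mod_cast h0))

/-! ### Reduced rings of characteristic 2, 3 and 5 -/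

theorem pow_three_eq_or [IsReduced R] (h : IsYaqubNilClean R) (a : R) : a ^ 3 = -a ∨ a ^ 3 = a :=
  (h a).imp (fun h ↦ (neg_eq_of_add_eq_zero_right (IsReduced.eq_zero _ h)).symm)
    fun h ↦ (sub_eq_zero.1 (IsReduced.eq_zero _ h)).symm

theorem isBooleanRing [IsReduced R] (h : IsYaqubNilClean R) (h2 : (2 : R) = 0) :
    IsBooleanRing R := by
  replace h2 (z : R) : z + z = 0 := by rw [← two_mul, h2, zero_mul]
  intro a
  have h3 : a ^ 3 = a := by
    rcases h.pow_three_eq_or a with h | h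
    · rw [h]
      linear_combination (norm := abel) -h2 a
    · exact h
  have h4 : a ^ 4 = a ^ 2 := by rw [pow_succ, h3, sq]
  have : a * a - a = 0 := by
    refine IsReduced.eq_zero _ ⟨2, ?_⟩
    have : (a * a - a) ^ 2 = a ^ 4 - (a ^ 3 + a ^ 3) + a ^ 2 := by noncomm_ring
    rw [this, h4, h2, sub_zero, h2]
  exact sub_eq_zero.1 this

/-- If `a ^ 3 = -a`, apply the dichotomy to `1 + a`, using `(1 + a) ^ 3 = 1 + a ^ 3`. -/
theorem pow_three_eq [IsReduced R] (h : IsYaqubNilClean R) (h3 : (3 : R) = 0) (a : R) :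
    a ^ 3 = a := by
  rcases h.pow_three_eq_or a with ha | ha
  swap
  · exact ha
  have hexp : (1 + a) ^ 3 = 1 + a ^ 3 := by
    have : (1 + a) ^ 3 = 1 + 3 * a + 3 * a ^ 2 + a ^ 3 := by noncomm_ring
    rw [this, h3]
    simp
  rcases h.pow_three_eq_or (1 + a) with h | h
  · rw [hexp, ha] at h
    have h3' : (1 : R) + 1 + 1 = 0 := by
      rw [← h3]
      norm_num
    have : (1 : R) = 0 := by linear_combination (norm := abel) h3' - h
    rw [← mul_one a, this, mul_zero, zero_pow three_ne_zero]
  · rw [hexp] at h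
    exact add_left_cancel h

end IsYaqubNilClean

/-- Each prime quotient is a domain with `z ^ 3 = z`, hence `ZMod 3`; the primes meet in zero. -/
theorem isYaqubRing_of_commRing {A : Type u} [CommRing A] [IsReduced A] (h3 : (3 : A) = 0)
    (hA : ∀ a : A, a ^ 3 = a) : IsYaqubRing A := by
  refine ⟨A →+* ZMod 3, RingHom.pi fun φ ↦ φ, ?_, fun φ ↦ ZMod.ringHom_surjective φ⟩
  rw [injective_iff_map_eq_zero]
  intro a ha
  refine IsReduced.eq_zero a (nilpotent_iff_mem_prime.2 fun P hP ↦ ?_)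
  have : CharP (A ⧸ P) 3 := (CharP.charP_iff_prime_eq_zero Nat.prime_three).2 (by
    exact_mod_cast (map_ofNat (Ideal.Quotient.mk P) 3).symm.trans (by rw [h3, map_zero]))
  have : Fact (Nat.Prime 3) := ⟨Nat.prime_three⟩
  have hbij : Function.Bijective (ZMod.castHom (dvd_refl 3) (A ⧸ P)) := by
    refine ⟨RingHom.injective _, fun x ↦ ?_⟩
    obtain ⟨x, rfl⟩ := Ideal.Quotient.mk_surjective x
    have hx := congrArg (Ideal.Quotient.mk P) (hA x)
    rw [map_pow] at hx
    generalize Ideal.Quotient.mk P x = z at hx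
    have hz : z * ((z - 1) * (z + 1)) = 0 := by linear_combination hx
    rcases mul_eq_zero.1 hz with h | h
    · exact ⟨0, by rw [map_zero, h]⟩
    rcases mul_eq_zero.1 h with h | h
    · exact ⟨1, by rw [map_one, sub_eq_zero.1 h]⟩
    · exact ⟨-1, by rw [map_neg, map_one, eq_neg_of_add_eq_zero_left h]⟩
  have h0 := congrFun ha ((RingEquiv.ofBijective _ hbij).symm.toRingHom.comp (Ideal.Quotient.mk P))
  exact Ideal.Quotient.eq_zero_iff_mem.1
    ((RingEquiv.ofBijective _ hbij).symm.map_eq_zero_iff.1 h0)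

theorem isYaqubRing_of_pow_three_eq {A : Type u} [Ring A] [IsReduced A] (h3 : (3 : A) = 0)
    (hA : ∀ a : A, a ^ 3 = a) : IsYaqubRing A := by
  have hcomm (a b : A) : a * b = b * a := by
    -- Squares are idempotent, hence central; then `(1 + a) ^ 2 = 1 - a + a ^ 2` makes `a` central.
    have hsq (c : A) : Commute (c ^ 2) b := by
      refine IsIdempotentElem.commute_of_isReduced ?_ b
      rw [IsIdempotentElem, ← pow_add, show 2 + 2 = 3 + 1 from rfl, pow_succ, hA, sq]
    have h := hsq (1 + a)
    have hexp : (1 + a) ^ 2 = 1 + (3 * a - a) + a ^ 2 := by noncomm_ring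
    rw [hexp, h3, zero_mul, zero_sub] at h
    have h' := (h.sub_left (hsq a)).sub_left (Commute.one_left b)
    rw [add_sub_cancel_right, add_sub_cancel_left] at h'
    exact (Commute.neg_left_iff.1 h').eq
  exact @isYaqubRing_of_commRing A { ‹Ring A› with mul_comm := hcomm } ‹_› h3 hA

theorem IsYaqubNilClean.nonempty_ringEquiv_zmod_five {A : Type*} [Ring A] [IsReduced A]
    [Nontrivial A] (h : IsYaqubNilClean A) (h5 : (5 : A) = 0) : Nonempty (A ≃+* ZMod 5) := by
  have h5' (z : A) : z + z + z + z + z = 0 := by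
    rw [← zero_mul z, ← h5]
    noncomm_ring
  -- Test `1 + 2e`, whose cube is `1 + 26e = 1 + e`.
  have hid {e : A} (he : IsIdempotentElem e) : e = 0 ∨ e = 1 := by
    have hexp : (1 + e + e) ^ 3 = 1 + e := by
      simp only [pow_three, mul_add, add_mul, he.eq, one_mul, mul_one]
      linear_combination (norm := abel) h5' (e + e + e + e + e)
    rcases h.pow_three_eq_or (1 + e + e) with h | h
    · right
      rw [hexp] at h
      linear_combination (norm := abel) h + h - h5' (1 + e)
    · left
      rw [hexp] at h
      linear_combination (norm := abel) -h
  have h2 {a : A} (ha : a ≠ 0) : a ^ 2 = 1 ∨ a ^ 2 = -1 := by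
    have h4 : a ^ 5 = a := by
      rw [show a ^ 5 = a ^ 3 * a ^ 2 by rw [← pow_add]]
      rcases h.pow_three_eq_or a with h | h
      · rw [h, neg_mul, ← pow_succ', h, neg_neg]
      · rw [h, ← pow_succ', h]
    have hid4 : IsIdempotentElem (a ^ 4) := by
      rw [IsIdempotentElem, ← pow_add, show 4 + 4 = 5 + 3 from rfl, pow_add, h4, ← pow_succ']
    rcases hid hid4 with h0 | h1
    · exact absurd (by rw [← h4, pow_succ, h0, zero_mul]) ha
    · rcases h.pow_three_eq_or a with h | h
      · right
        rw [pow_succ, h, neg_mul, ← sq] at h1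
        rw [← h1, neg_neg]
      · left
        rwa [pow_succ, h, ← sq] at h1
  have hdom {a b : A} (hab : a * b = 0) : a = 0 ∨ b = 0 := by
    by_contra! hne
    rcases h2 hne.1 with h | h
    · exact hne.2 (by rw [← one_mul b, ← h, sq, mul_assoc, hab, mul_zero])
    · exact hne.2 (by rw [← neg_neg b, ← neg_one_mul b, ← h, sq, mul_assoc, hab, mul_zero,
        neg_zero])
  have : CharP A 5 := (CharP.charP_iff_prime_eq_zero Nat.prime_five).2 (mod_cast h5)
  have : Fact (Nat.Prime 5) := ⟨Nat.prime_five⟩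
  have hbij : Function.Bijective (ZMod.castHom (dvd_refl 5) A) := by
    refine ⟨RingHom.injective _, fun a ↦ ?_⟩
    by_cases ha : a = 0
    · exact ⟨0, by rw [map_zero, ha]⟩
    rcases h2 ha with h | h
    · rcases hdom (show (a - 1) * (a + 1) = 0 by
        rw [show (a - 1) * (a + 1) = a ^ 2 - 1 by noncomm_ring, h, sub_self]) with h | h
      · exact ⟨1, by rw [map_one, sub_eq_zero.1 h]⟩
      · exact ⟨-1, by rw [map_neg, map_one, eq_neg_of_add_eq_zero_left h]⟩
    -- Here `-1 = 2 ^ 2`, so `a = ± 2`.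
    · rcases hdom (show (a - (1 + 1)) * (a + (1 + 1)) = 0 by
        rw [sq] at h
        simp only [mul_add, sub_mul, add_mul, one_mul, mul_one]
        linear_combination (norm := abel) h - h5' 1) with h | h
      · exact ⟨1 + 1, by rw [map_add, map_one, sub_eq_zero.1 h]⟩
      · exact ⟨-(1 + 1), by rw [map_neg, map_add, map_one, eq_neg_of_add_eq_zero_left h]⟩
  exact ⟨(RingEquiv.ofBijective _ hbij).symm⟩

/-! ### Converse and splitting -/

section Classification

variable {R : Type u} [Ring R]

theorem IsYaqubNilClean.isNilBoolean (h : IsYaqubNilClean R) (h2 : IsNilpotent (2 : R)) :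
    IsNilBoolean R := by
  obtain ⟨h0, _⟩ := h.isReduced_quotient_jacobson (p := 2) (mod_cast h2) (by decide)
  exact ⟨(h.of_surjective _ Ideal.Quotient.mk_surjective).isBooleanRing (mod_cast h0),
    h.jacobsonIsNil⟩

theorem IsYaqubNilClean.isNilYaqub (h : IsYaqubNilClean R) (h3 : IsNilpotent (3 : R)) :
    IsNilYaqub R := by
  obtain ⟨h0, _⟩ := h.isReduced_quotient_jacobson (p := 3) (mod_cast h3) (by decide)
  have h0' : (3 : R ⧸ Ring.jacobson R) = 0 := mod_cast h0
  exact ⟨isYaqubRing_of_pow_three_eq h0'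
    ((h.of_surjective _ Ideal.Quotient.mk_surjective).pow_three_eq h0'), h.jacobsonIsNil⟩

theorem IsYaqubNilClean.isNilZModFive [Nontrivial R] (h : IsYaqubNilClean R)
    (h5 : IsNilpotent (5 : R)) : IsNilZModFive R := by
  obtain ⟨h0, _⟩ := h.isReduced_quotient_jacobson (p := 5) (mod_cast h5) (by decide)
  have : Nontrivial (R ⧸ Ring.jacobson R) :=
    Ideal.Quotient.nontrivial_iff.2 (Ring.jacobson_lt_top R).ne
  exact ⟨(h.of_surjective _ Ideal.Quotient.mk_surjective).nonempty_ringEquiv_zmod_five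
    (mod_cast h0), h.jacobsonIsNil⟩

theorem IsNilBoolean.isNilpotent (h : IsNilBoolean R) (a : R) :
    IsNilpotent (a + a ^ 3) ∧ IsNilpotent (a - a ^ 3) := by
  have hadd (b : R ⧸ Ring.jacobson R) : b + b = 0 := by
    have := (h.1 (b + b)).eq
    rw [mul_add, add_mul, (h.1 b).eq] at this
    exact left_eq_add.1 this.symm
  refine ⟨isNilpotent_of_mk_eq_zero h.2 ?_, isNilpotent_of_mk_eq_zero h.2 ?_⟩
  · rw [map_add, map_pow, (h.1 _).pow_eq three_ne_zero, hadd]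
  · rw [map_sub, map_pow, (h.1 _).pow_eq three_ne_zero, sub_self]

theorem IsNilBoolean.isYaqubNilClean (h : IsNilBoolean R) : IsYaqubNilClean R :=
  fun a ↦ .inl (h.isNilpotent a).1

theorem IsNilYaqub.isYaqubNilClean (h : IsNilYaqub R) : IsYaqubNilClean R := by
  obtain ⟨⟨I, f, hf, -⟩, hJ⟩ := h
  refine fun a ↦ .inr (isNilpotent_of_mk_eq_zero hJ (hf ?_))
  ext i
  simp only [map_sub, map_pow, map_zero, Pi.sub_apply, Pi.pow_apply, Pi.zero_apply]
  have hz (z : ZMod 3) : z - z ^ 3 = 0 := by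
    revert z
    decide
  exact hz _

theorem IsNilZModFive.isYaqubNilClean (h : IsNilZModFive R) : IsYaqubNilClean R := by
  obtain ⟨⟨f⟩, hJ⟩ := h
  intro a
  have hz (z : ZMod 5) : z + z ^ 3 = 0 ∨ z - z ^ 3 = 0 := by
    revert z
    decide
  refine (hz (f (Ideal.Quotient.mk _ a))).imp (fun h ↦ ?_) fun h ↦ ?_
  · refine isNilpotent_of_mk_eq_zero hJ (f.map_eq_zero_iff.1 ?_)
    simpa using h
  · refine isNilpotent_of_mk_eq_zero hJ (f.map_eq_zero_iff.1 ?_)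
    simpa using h

theorem IsNilpotent.prodMk {S T : Type*} [MonoidWithZero S] [MonoidWithZero T] {x : S × T}
    (h₁ : IsNilpotent x.1) (h₂ : IsNilpotent x.2) : IsNilpotent x := by
  obtain ⟨m, hm⟩ := h₁
  obtain ⟨n, hn⟩ := h₂
  exact ⟨m + n, Prod.ext (by simp [pow_add, hm]) (by simp [pow_add, hn])⟩

theorem IsNilBoolean.isYaqubNilClean_prod (h : IsNilBoolean R) {S : Type*} [Ring S]
    (hS : IsYaqubNilClean S) : IsYaqubNilClean (R × S) := fun a ↦
  (hS a.2).imp (fun h' ↦ .prodMk (h.isNilpotent a.1).1 h')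
    fun h' ↦ .prodMk (h.isNilpotent a.1).2 h'

theorem IsYaqubNilClean.of_ringEquiv {S : Type*} [Ring S] (hS : IsYaqubNilClean S) (f : R ≃+* S) :
    IsYaqubNilClean R :=
  hS.of_surjective f.symm.toRingHom f.symm.surjective

instance Ideal.isTwoSided_span_natCast (n : ℕ) : (Ideal.span {(n : R)}).IsTwoSided := by
  refine ⟨fun {a} b ha ↦ ?_⟩
  obtain ⟨c, rfl⟩ := Ideal.mem_span_singleton'.1 ha
  rw [mul_assoc, (Nat.cast_commute n b).eq, ← mul_assoc]
  exact Ideal.mem_span_singleton'.2 ⟨_, rfl⟩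

/-- Splitting a noncommutative ring along a coprime factorization of its characteristic. -/
theorem nonempty_ringEquiv_prod_of_coprime {m n : ℕ} (hmn : m.Coprime n)
    (h0 : (m : R) * (n : R) = 0) :
    Nonempty (R ≃+* (R ⧸ Ideal.span {(m : R)}) × (R ⧸ Ideal.span {(n : R)})) := by
  obtain ⟨u, v, huv⟩ : ∃ u v : R, u * m + v * n = 1 := by
    obtain ⟨u, v, huv⟩ := Nat.isCoprime_iff_coprime.2 hmn
    exact ⟨u, v, mod_cast congrArg (Int.cast : ℤ → R) huv⟩
  have hu : Ideal.Quotient.mk (Ideal.span {(m : R)}) (u * m) = 0 :=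
    Ideal.Quotient.eq_zero_iff_mem.2 (Ideal.mem_span_singleton'.2 ⟨u, rfl⟩)
  have hv : Ideal.Quotient.mk (Ideal.span {(n : R)}) (v * n) = 0 :=
    Ideal.Quotient.eq_zero_iff_mem.2 (Ideal.mem_span_singleton'.2 ⟨v, rfl⟩)
  have hu' : Ideal.Quotient.mk (Ideal.span {(n : R)}) (u * m) = 1 := by
    rw [eq_sub_of_add_eq huv, map_sub, hv, sub_zero, map_one]
  have hv' : Ideal.Quotient.mk (Ideal.span {(m : R)}) (v * n) = 1 := by
    rw [eq_sub_of_add_eq' huv, map_sub, hu, sub_zero, map_one]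
  refine ⟨RingEquiv.ofBijective ((Ideal.Quotient.mk _).prod (Ideal.Quotient.mk _)) ⟨?_, ?_⟩⟩
  · rw [injective_iff_map_eq_zero]
    intro x hx
    obtain ⟨a, ha⟩ := Ideal.mem_span_singleton'.1
      (Ideal.Quotient.eq_zero_iff_mem.1 (Prod.ext_iff.1 hx).1)
    obtain ⟨b, hb⟩ := Ideal.mem_span_singleton'.1
      (Ideal.Quotient.eq_zero_iff_mem.1 (Prod.ext_iff.1 hx).2)
    have hmx : (m : R) * x = 0 := by
      rw [← hb, ← mul_assoc, (Nat.cast_commute m b).eq, mul_assoc, h0, mul_zero]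
    have hnx : (n : R) * x = 0 := by
      rw [← ha, ← mul_assoc, (Nat.cast_commute n a).eq, mul_assoc, (Nat.cast_commute n _).eq, h0,
        mul_zero]
    rw [← one_mul x, ← huv, add_mul, mul_assoc, mul_assoc, hmx, hnx, mul_zero, mul_zero, add_zero]
  · rintro ⟨x, y⟩
    obtain ⟨x, rfl⟩ := Ideal.Quotient.mk_surjective x
    obtain ⟨y, rfl⟩ := Ideal.Quotient.mk_surjective y
    refine ⟨v * n * x + u * m * y, Prod.ext ?_ ?_⟩
    · change Ideal.Quotient.mk _ _ = Ideal.Quotient.mk _ _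
      rw [map_add, map_mul _ (v * (n : R)), map_mul _ (u * (m : R)), hu, hv', one_mul,
        zero_mul, add_zero]
    · change Ideal.Quotient.mk _ _ = Ideal.Quotient.mk _ _
      rw [map_add, map_mul _ (v * (n : R)), map_mul _ (u * (m : R)), hu', hv, one_mul,
        zero_mul, zero_add]

theorem isNilpotent_natCast_quotient_span_pow (p k : ℕ) :
    IsNilpotent (p : R ⧸ Ideal.span {((p ^ k : ℕ) : R)}) := by
  refine ⟨k, ?_⟩
  rw [← Nat.cast_pow, ← map_natCast (Ideal.Quotient.mk _), Ideal.Quotient.eq_zero_iff_mem]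
  exact Ideal.mem_span_singleton_self _

/-- A Yaqub nil-clean ring in which `2 * p` is nilpotent, `p` odd, splits. -/
theorem IsYaqubNilClean.exists_ringEquiv_prod (h : IsYaqubNilClean R) {p : ℕ}
    (hp : Nat.Coprime 2 p) (hn : IsNilpotent ((2 * p : ℕ) : R)) :
    ∃ (S T : Type u) (_ : Ring S) (_ : Ring T), IsNilBoolean S ∧ IsYaqubNilClean T ∧
      IsNilpotent (p : T) ∧ Nonempty (R ≃+* S × T) := by
  obtain ⟨k, hk⟩ := hn
  refine ⟨R ⧸ Ideal.span {((2 ^ k : ℕ) : R)}, R ⧸ Ideal.span {((p ^ k : ℕ) : R)}, inferInstance,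
    inferInstance, ?_, h.of_surjective _ Ideal.Quotient.mk_surjective,
    isNilpotent_natCast_quotient_span_pow p k,
    nonempty_ringEquiv_prod_of_coprime (hp.pow k k) ?_⟩
  · exact (h.of_surjective _ Ideal.Quotient.mk_surjective).isNilBoolean
      (mod_cast isNilpotent_natCast_quotient_span_pow 2 k)
  · rw [← Nat.cast_mul, ← mul_pow, Nat.cast_pow, hk]

end Classification

theorem theorem3p1 (R : Type u) [Ring R] :
    IsYaqubNilClean R ↔
      (∃ (R₁ : Type u) (_ : Ring R₁), IsNilBoolean R₁ ∧ Nonempty (R ≃+* R₁)) ∨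
      (∃ (R₂ : Type u) (_ : Ring R₂), IsNilYaqub R₂ ∧ Nonempty (R ≃+* R₂)) ∨
      (∃ (R₃ : Type u) (_ : Ring R₃), IsNilZModFive R₃ ∧ Nonempty (R ≃+* R₃)) ∨
      (∃ (R₁ R₂ : Type u) (_ : Ring R₁) (_ : Ring R₂),
        IsNilBoolean R₁ ∧ IsNilYaqub R₂ ∧ Nonempty (R ≃+* R₁ × R₂)) ∨
      (∃ (R₁ R₃ : Type u) (_ : Ring R₁) (_ : Ring R₃),
        IsNilBoolean R₁ ∧ IsNilZModFive R₃ ∧ Nonempty (R ≃+* R₁ × R₃)) := by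
  constructor
  · intro h
    rcases h 2 with h2 | h2
    · obtain ⟨S, T, _, _, hS, hT, h5, ⟨f⟩⟩ := h.exists_ringEquiv_prod (p := 5) (by decide)
        (by convert h2 using 1; norm_num)
      -- The zero ring is Boolean and Yaqub but has no quotient `ZMod 5`, so only here must `T = 0`
      -- be set apart.
      rcases subsingleton_or_nontrivial T with _ | _
      · exact .inl ⟨S, _, hS, ⟨f.trans (RingEquiv.prodZeroRing S T).symm⟩⟩
      · exact .inr (.inr (.inr (.inr ⟨S, T, _, _, hS, hT.isNilZModFive (mod_cast h5), ⟨f⟩⟩)))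
    · obtain ⟨S, T, _, _, hS, hT, h3, f⟩ := h.exists_ringEquiv_prod (p := 3) (by decide)
        (by rw [← isNilpotent_neg_iff]; convert h2 using 1; norm_num)
      exact .inr (.inr (.inr (.inl ⟨S, T, _, _, hS, hT.isNilYaqub (mod_cast h3), f⟩)))
  · rintro (⟨S, _, hS, ⟨f⟩⟩ | ⟨S, _, hS, ⟨f⟩⟩ | ⟨S, _, hS, ⟨f⟩⟩ | ⟨S, T, _, _, hS, hT, ⟨f⟩⟩ |
      ⟨S, T, _, _, hS, hT, ⟨f⟩⟩)
    · exact hS.isYaqubNilClean.of_ringEquiv f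
    · exact hS.isYaqubNilClean.of_ringEquiv f
    · exact hS.isYaqubNilClean.of_ringEquiv f
    · exact (hS.isYaqubNilClean_prod hT.isYaqubNilClean).of_ringEquiv f
    · exact (hS.isYaqubNilClean_prod hT.isYaqubNilClean).of_ringEquiv f
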